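/- Identify $\mathbb{R}^4$ with $\mathbb{C}^2$ (coordinates $z_j=x_j+iy_j$) and let $J$ be multiplication by $i$, $\langle\cdot,\cdot\rangle$ the Euclidean inner product, $\omega_0=\sum_j dx_j\wedge dy_j$ and $\lambda_0=\frac12\sum_j(x_j\,dy_j-y_j\,dx_j)$. Let $C\subset\mathbb{C}^2$ be a compact strictly convex body with smooth boundary $\Sigma$ which contains the origin in its interior, let $N$ be the outer unit normal field of $\Sigma$, and let $a\ge b\ge c$ be the principal curvatures of $\Sigma$, i.e. the eigenvalues, counted with multiplicity, of the shape operator $dN$ on $T\Sigma$. Let $\lambda=\lambda_0|_{T\Sigma}$ be the contact form, $\xi=\ker\lambda$ the contact bundle, and $\Psi_t:\Sigma\to\Sigma$ the Reeb flow, i.e. the flow of the vector field $X$ on $\Sigma$ with $\lambda(X)=1$ and $d\lambda(X,\cdot)=0$. Maslov index. Put $M=\hat M\circ N$ with $\hat M(z_1,z_2)=(-\bar z_2,\bar z_1)$. For $q\in\Sigma$ the map $T_q:\xi_q\to\mathbb{R}^2$, $T_q(v)=(\langle M(q),v\rangle,\langle JM(q),v\rangle)$, is an area preserving isomorphism. For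 a periodic Reeb orbit $\gamma(t)=\Psi_t(p)$ of period $T>0$ (not necessarily the minimal one) consider the path $\Phi(t)=T_{\Psi_t(p)}\circ d\Psi_t(p)\circ T_p^{-1}$, $t\in[0,T]$, in $SL(2,\mathbb{R})$, and for a unit vector $Y\in\mathbb{R}^2$ let $\mathrm{rot}(\Phi,Y)$ be the total (counter-clockwise) rotation angle of the curve $t\mapsto\Phi(t)Y/\|\Phi(t)Y\|$ on $[0,T]$. The Maslov index $\mu(\gamma)$ is $2k+1$ if $\mathrm{rot}(\Phi,Y)\in(2k\pi,2(k+1)\pi)$ for all unit vectors $Y$, for some $k\in\mathbb{Z}$; otherwise there are a unique $k\in\mathbb{Z}$ and some unit vector $Y$ with $\mathrm{rot}(\Phi,Y)=2k\pi$, and $\mu(\gamma)=2k$. Total curvature. The total curvature of $\gamma$ is $\kappa(\gamma)=\int_0^{\ell}\|\sigma''(s)\|\,ds$, where $\ell$ is the length of $\gamma|_{[0,T]}$ and $\sigma:[0,\ell]\to\Sigma$ is its parametrization by arc length. Claim: if $a(q)\le b(q)+c(q)$ for every $q\in\Sigma$, then every periodic Reeb orbit $\gamma$ on $\Sigma$ with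 $\mu(\gamma)=3$ satisfies $\kappa(\gamma)<4\pi$. -/

import Mathlib

open Real Set Topology MeasureTheory
open scoped ContDiff

noncomputable section

namespace ReebConvex

/-- `ℝ⁴ = ℂ²`, with coordinates `(x₁, y₁, x₂, y₂)`, i.e. `z₁ = x₁ + i y₁`, `z₂ = x₂ + i y₂`,
and the Euclidean inner product and norm. -/
abbrev E4 := EuclideanSpace ℝ (Fin 4)

/-- `ℝ²` with the Euclidean norm. -/
abbrev E2 := EuclideanSpace ℝ (Fin 2)

/-- The complex structure `J` of `ℂ²`: multiplication by `i`. -/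
def J : E4 →ₗ[ℝ] E4 where
  toFun v := !₂[-(v 1), v 0, -(v 3), v 2]
  map_add' u v := by
    ext i; fin_cases i <;> simp <;> ring
  map_smul' r v := by
    ext i; fin_cases i <;> simp

/-- The conjugate linear map `(z₁, z₂) ↦ (-z̄₂, z̄₁)` of `ℂ²`. -/
def Mhat : E4 →ₗ[ℝ] E4 where
  toFun v := !₂[-(v 2), v 3, v 0, -(v 1)]
  map_add' u v := by
    ext i; fin_cases i <;> simp <;> ring
  map_smul' r v := by
    ext i; fin_cases i <;> simp

/-- The standard symplectic form `ω₀ = dx₁ ∧ dy₁ + dx₂ ∧ dy₂ = dλ₀`. -/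
def omega0 (u v : E4) : ℝ := (u 0 * v 1 - u 1 * v 0) + (u 2 * v 3 - u 3 * v 2)

/-- The one-form `λ₀ = ½ ∑ (xᵢ dyᵢ - yᵢ dxᵢ)`, at the point `p`, on the vector `v`. -/
def lambda0 (p v : E4) : ℝ := (1 / 2) * ((p 0 * v 1 - p 1 * v 0) + (p 2 * v 3 - p 3 * v 2))

/-! ### Smooth boundary, unit normal, tangent space -/

/-- `ρ` is a smooth function near `p` which defines `C` near `p`: its differential does not vanish
at `p`, and near `p` the set `C` is the sublevel set `{ρ ≤ 0}`. -/
def IsLocalDefiningFunction (C : Set E4) (p : E4) (ρ : E4 → ℝ) : Prop :=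
  ∃ U : Set E4, IsOpen U ∧ p ∈ U ∧ ContDiffOn ℝ ∞ ρ U ∧ ρ p = 0 ∧ gradient ρ p ≠ 0 ∧
    ∀ x ∈ U, x ∈ C ↔ ρ x ≤ 0

/-- The boundary of `C` is smooth: a smooth hypersurface with `C` on one side. -/
def HasSmoothBoundary (C : Set E4) : Prop :=
  ∀ p ∈ frontier C, ∃ ρ : E4 → ℝ, IsLocalDefiningFunction C p ρ

/-- `n` is the outer unit normal of `C` at the boundary point `p`: the normalized gradient of a
local defining function. -/
def IsOuterUnitNormal (C : Set E4) (p n : E4) : Prop :=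
  ∃ ρ : E4 → ℝ, IsLocalDefiningFunction C p ρ ∧ n = ‖gradient ρ p‖⁻¹ • gradient ρ p

/-- The outer unit normal field `N` of `Σ = ∂C` (meaningful at points of `Σ`). -/
def N (C : Set E4) (p : E4) : E4 := Classical.epsilon (IsOuterUnitNormal C p)

theorem isOuterUnitNormal_norm {C : Set E4} {p n : E4} (h : IsOuterUnitNormal C p n) : ‖n‖ = 1 := by
  obtain ⟨ρ, ⟨U, -, -, -, -, h, -⟩, rfl⟩ := h
  rw [norm_smul, norm_inv, norm_norm, inv_mul_cancel₀ (norm_ne_zero_iff.2 h)]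

/-- The outer unit normal is well defined. -/
theorem isOuterUnitNormal_unique {C : Set E4} {p m n : E4}
    (hm : IsOuterUnitNormal C p m) (hn : IsOuterUnitNormal C p n) : m = n := by
  have hm1 := isOuterUnitNormal_norm hm
  have hn1 := isOuterUnitNormal_norm hn
  by_contra hne
  have hlt : inner ℝ m n < 1 := by
    refine lt_of_le_of_ne ?_ ?_
    · have := real_inner_le_norm m n
      rwa [hm1, hn1, one_mul] at this
    · intro h
      exact hne ((inner_eq_one_iff_of_norm_eq_one hm1 hn1).1 h)
  -- the sign of a defining function along the line through `p` in direction `w`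
  have key : ∀ k : E4, IsOuterUnitNormal C p k → ∀ w : E4,
      (inner ℝ k w < 0 → ∀ᶠ t in 𝓝[>] (0 : ℝ), p + t • w ∈ C) ∧
      (0 < inner ℝ k w → ∀ᶠ t in 𝓝[>] (0 : ℝ), p + t • w ∉ C) := by
    rintro k ⟨ρ, ⟨U, hU, hpU, hρ, h0, hg, hC⟩, rfl⟩ w
    have hd : DifferentiableAt ℝ ρ p :=
      (hρ.contDiffAt (hU.mem_nhds hpU)).differentiableAt (by simp)
    have hline : HasDerivAt (fun t : ℝ => p + t • w) w 0 := by
      simpa using ((hasDerivAt_id (0 : ℝ)).smul_const w).const_add p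
    have hcomp : HasDerivAt (fun t : ℝ => ρ (p + t • w)) (inner ℝ (gradient ρ p) w) 0 := by
      have h1 : HasFDerivAt ρ (fderiv ℝ ρ p) (p + (0 : ℝ) • w) := by
        simpa using hd.hasFDerivAt
      have h2 : inner ℝ (gradient ρ p) w = fderiv ℝ ρ p w := by simp [gradient]
      rw [h2]
      exact h1.comp_hasDerivAt (0 : ℝ) hline
    have hUev : ∀ᶠ t in 𝓝[>] (0 : ℝ), p + t • w ∈ U := by
      refine (hline.continuousAt.eventually_mem (hU.mem_nhds ?_)).filter_mono nhdsWithin_le_nhds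
      simpa using hpU
    have hpos : 0 < ‖gradient ρ p‖⁻¹ := inv_pos.2 (norm_pos_iff.2 hg)
    have hsl := hcomp.hasDerivWithinAt (s := Ioi 0)
    rw [hasDerivWithinAt_iff_tendsto_slope' (by simp)] at hsl
    rw [real_inner_smul_left]
    constructor
    · intro hw
      have hw' : inner ℝ (gradient ρ p) w < 0 := by
        by_contra hh; exact absurd hw (not_lt.2 (mul_nonneg hpos.le (not_lt.1 hh)))
      filter_upwards [hUev, hsl.eventually_lt_const hw', self_mem_nhdsWithin] with t h1 h2 h3
      rw [hC _ h1]
      simp [slope, h0] at h2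
      have h3' : (0 : ℝ) < t⁻¹ := inv_pos.2 h3
      nlinarith
    · intro hw
      have hw' : 0 < inner ℝ (gradient ρ p) w := pos_of_mul_pos_right hw hpos.le
      filter_upwards [hUev, hsl.eventually_const_lt hw', self_mem_nhdsWithin] with t h1 h2 h3
      rw [hC _ h1]
      simp [slope, h0] at h2
      have h3' : (0 : ℝ) < t⁻¹ := inv_pos.2 h3
      intro h4
      nlinarith
  have h1 := (key m hm (n - m)).1 (by
    rw [inner_sub_right, real_inner_self_eq_norm_sq, hm1]; linarith)
  have h2 := (key n hn (n - m)).2 (by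
    rw [inner_sub_right, real_inner_self_eq_norm_sq, hn1, real_inner_comm]; linarith)
  obtain ⟨t, ht1, ht2⟩ := (h1.and h2).exists
  exact ht2 ht1

theorem isOuterUnitNormal_N {C : Set E4} (hC : HasSmoothBoundary C) {p : E4}
    (hp : p ∈ frontier C) : IsOuterUnitNormal C p (N C p) := by
  obtain ⟨ρ, hρ⟩ := hC p hp
  exact Classical.epsilon_spec (p := IsOuterUnitNormal C p) ⟨_, ρ, hρ, rfl⟩

/-- The tangent space `T_pΣ` of `Σ = ∂C` at `p`: the vectors orthogonal to the normal. -/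
def tangent (C : Set E4) (p : E4) : Submodule ℝ E4 := (ℝ ∙ N C p)ᗮ

/-! ### Curvature -/

/-- The shape operator `A = dN` of `Σ = ∂C` at `p`. It is meaningful on the tangent space `T_pΣ`,
where the derivative of `N` along `Σ` is determined by the values of `N` on `Σ`. -/
def shapeOperator (C : Set E4) (p : E4) : E4 →L[ℝ] E4 := fderivWithin ℝ (N C) (frontier C) p

/-- `a ≥ b ≥ c` are the principal curvatures of `Σ = ∂C` at `p`: the eigenvalues, with
multiplicity, of the shape operator on the three-dimensional space `T_pΣ`. -/
def ArePrincipalCurvatures (C : Set E4) (p : E4) (a b c : ℝ) : Prop :=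
  b ≤ a ∧ c ≤ b ∧ ∃ e : Fin 3 → E4, Orthonormal ℝ e ∧ (∀ i, e i ∈ tangent C p) ∧
    ∀ i, shapeOperator C p (e i) = (![a, b, c] : Fin 3 → ℝ) i • e i

/-! ### Reeb flow -/

/-- `w` is the value at `p ∈ Σ` of the Reeb vector field `X` of the contact form `λ = λ₀|_{TΣ}`:
`X` is tangent to `Σ`, `λ(X) = 1` and `dλ(X, ·) = 0` on `TΣ`. -/
def IsReebVector (C : Set E4) (p w : E4) : Prop :=
  w ∈ tangent C p ∧ lambda0 p w = 1 ∧ ∀ v ∈ tangent C p, omega0 w v = 0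

/-- `Ψ` is the Reeb flow on `Σ = ∂C` (its values off `Σ` are irrelevant). -/
def IsReebFlow (C : Set E4) (Ψ : ℝ → E4 → E4) : Prop :=
  ∀ p ∈ frontier C, Ψ 0 p = p ∧ ∀ t : ℝ, Ψ t p ∈ frontier C ∧
    ∃ w : E4, IsReebVector C (Ψ t p) w ∧ HasDerivAt (fun s => Ψ s p) w t

/-! ### The symplectic trivialization of the contact bundle -/

/-- The contact plane `ξ_p = ker λ ⊆ T_pΣ`. -/
def contactPlane (C : Set E4) (p : E4) : Set E4 := {v | v ∈ tangent C p ∧ lambda0 p v = 0}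

/-- The section `M = M̂ ∘ N` of `TΣ`; `M, JM` is a frame of the complex line bundle
`L ⊆ TΣ`, the orthogonal complement of the span of `N` and `JN`. -/
def M (C : Set E4) (p : E4) : E4 := Mhat (N C p)

/-- The trivialization `T_p : ξ_p → ℝ²`: the orthogonal projection to `L_p`, in the coordinates
given by the frame `M, JM` (defined by the same formula on all of `ℝ⁴`). -/
def triv (C : Set E4) (p : E4) : E4 →ₗ[ℝ] E2 where
  toFun v := !₂[inner ℝ (M C p) v, inner ℝ (J (M C p)) v]
  map_add' u v := by
    ext i; fin_cases i <;> simp [inner_add_right]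
  map_smul' r v := by
    ext i; fin_cases i <;> simp [inner_smul_right]

/-- The inverse `T_p⁻¹ : ℝ² → ξ_p` of the trivialization: a vector of `L_p` is
moved into `ξ_p = ker λ` by subtracting a multiple of `JN`. -/
def trivInv (C : Set E4) (p : E4) : E2 →ₗ[ℝ] E4 where
  toFun x := (x 0 • M C p + x 1 • J (M C p)) -
    (lambda0 p (x 0 • M C p + x 1 • J (M C p)) / lambda0 p (J (N C p))) • J (N C p)
  map_add' x y := by
    ext i; simp [lambda0]; ring
  map_smul' r x := by
    ext i; simp [lambda0]; ring

/-- `trivInv` takes values in the contact plane. -/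
theorem trivInv_mem (C : Set E4) (p : E4) (hl : lambda0 p (J (N C p)) ≠ 0) (x : E2) :
    trivInv C p x ∈ contactPlane C p := by
  constructor
  · rw [tangent, Submodule.mem_orthogonal_singleton_iff_inner_right]
    simp [trivInv, M, J, Mhat, PiLp.inner_apply, Fin.sum_univ_four]
    ring
  · have hlin : ∀ u v : E4, ∀ r : ℝ, lambda0 p (u - r • v) = lambda0 p u - r * lambda0 p v := by
      intro u v r; simp [lambda0]; ring
    simp only [trivInv, LinearMap.coe_mk, AddHom.coe_mk, hlin]
    field_simp
    ring

/-- `triv` is a left inverse of `trivInv`. -/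
theorem triv_trivInv (C : Set E4) (p : E4) (hN : ‖N C p‖ = 1) (x : E2) :
    triv C p (trivInv C p x) = x := by
  have h : N C p 0 ^ 2 + N C p 1 ^ 2 + N C p 2 ^ 2 + N C p 3 ^ 2 = 1 := by
    have := EuclideanSpace.real_norm_sq_eq (N C p)
    rw [hN, Fin.sum_univ_four] at this
    linarith
  ext i; fin_cases i
  · simp [triv, trivInv, M, J, Mhat, PiLp.inner_apply, Fin.sum_univ_four]
    linear_combination x 0 * h
  · simp [triv, trivInv, M, J, Mhat, PiLp.inner_apply, Fin.sum_univ_four]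
    linear_combination x 1 * h

/-- On the contact plane, `triv` is also a right inverse of `trivInv`. -/
theorem trivInv_triv (C : Set E4) (p : E4) (hN : ‖N C p‖ = 1) (hl : lambda0 p (J (N C p)) ≠ 0)
    {v : E4} (hv : v ∈ contactPlane C p) : trivInv C p (triv C p v) = v := by
  have h : N C p 0 ^ 2 + N C p 1 ^ 2 + N C p 2 ^ 2 + N C p 3 ^ 2 = 1 := by
    have := EuclideanSpace.real_norm_sq_eq (N C p)
    rw [hN, Fin.sum_univ_four] at this
    linarith
  obtain ⟨hv1, hv2⟩ := hv
  rw [tangent, Submodule.mem_orthogonal_singleton_iff_inner_right] at hv1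
  have hv3 : v = ((triv C p v) 0 • M C p + (triv C p v) 1 • J (M C p)) +
      (inner ℝ (J (N C p)) v) • J (N C p) := by
    simp [PiLp.inner_apply, Fin.sum_univ_four] at hv1
    ext i; fin_cases i <;>
      simp [triv, M, J, Mhat, PiLp.inner_apply, Fin.sum_univ_four]
    · linear_combination -(v 0) * h + N C p 0 * hv1
    · linear_combination -(v 1) * h + N C p 1 * hv1
    · linear_combination -(v 2) * h + N C p 2 * hv1
    · linear_combination -(v 3) * h + N C p 3 * hv1
  set w := (triv C p v) 0 • M C p + (triv C p v) 1 • J (M C p) with hw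
  have hlin : ∀ u v : E4, ∀ r : ℝ, lambda0 p (u + r • v) = lambda0 p u + r * lambda0 p v := by
    intro u v r; simp [lambda0]; ring
  have h4 : lambda0 p w / lambda0 p (J (N C p)) = - inner ℝ (J (N C p)) v := by
    rw [hv3, hlin] at hv2
    field_simp
    linarith
  change w - (lambda0 p w / lambda0 p (J (N C p))) • J (N C p) = v
  rw [h4, neg_smul, sub_neg_eq_add]
  exact hv3.symm

/-- The linearized Reeb flow along the orbit of `p`, in the trivialization of the contact bundle:
`Φ(t) = T_{Ψ_t p} ∘ dΨ_t(p) ∘ T_p⁻¹`, a path in `SL(2, ℝ)` starting at the identity.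
The derivative `dΨ_t(p)` of `Ψ_t : Σ → Σ` is only evaluated on tangent vectors
of `Σ`, where it is determined by the values of `Ψ_t` on `Σ`. -/
def linearizedFlow (C : Set E4) (Ψ : ℝ → E4 → E4) (p : E4) (t : ℝ) : E2 →ₗ[ℝ] E2 :=
  triv C (Ψ t p) ∘ₗ (fderivWithin ℝ (Ψ t) (frontier C) p : E4 →ₗ[ℝ] E4) ∘ₗ trivInv C p

/-! ### Rotation and Maslov index of a path of linear maps of the plane -/

/-- `r` is the total rotation angle on `[0, χ]` of the curve `t ↦ u(t) / ‖u(t)‖` in the unit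
circle. -/
def IsTotalRotation (χ : ℝ) (u : ℝ → E2) (r : ℝ) : Prop :=
  ∃ θ : ℝ → ℝ, ContinuousOn θ (Icc 0 χ) ∧
    (∀ t ∈ Icc 0 χ, u t ≠ 0 ∧ ‖u t‖⁻¹ • u t = !₂[cos (θ t), sin (θ t)]) ∧ r = θ χ - θ 0

/-- The path `c : [0, χ] → SL(2, ℝ)`, `c(0) = Id`, has Maslov index `μ`. Write `rot(c, X)` for the
total rotation of `t ↦ c(t) X`. If for some integer `k` every unit vector `X` satisfies
`2kπ < rot(c, X) < 2(k+1)π` then `μ = 2k + 1`; otherwise there are an integer `k` and a unit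
vector `X` with `rot(c, X) = 2kπ`, and `μ = 2k`. -/
def HasMaslovIndex (χ : ℝ) (c : ℝ → E2 →ₗ[ℝ] E2) (μ : ℤ) : Prop :=
  (∃ k : ℤ, μ = 2 * k + 1 ∧ ∀ X : E2, ‖X‖ = 1 →
    ∃ r : ℝ, IsTotalRotation χ (fun t => c t X) r ∧ 2 * k * π < r ∧ r < 2 * (k + 1) * π) ∨
  (∃ k : ℤ, μ = 2 * k ∧ ∃ X : E2, ‖X‖ = 1 ∧ IsTotalRotation χ (fun t => c t X) (2 * k * π))

/-! ### Total curvature -/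

/-- The arc length function of a curve, based at the parameter `0`. -/
def arcLength (γ : ℝ → E4) (t : ℝ) : ℝ := ∫ s in (0 : ℝ)..t, ‖deriv γ s‖

/-- The parametrization by arc length of a regular curve. -/
def arcLengthParam (γ : ℝ → E4) : ℝ → E4 := γ ∘ Function.invFun (arcLength γ)

/-- The total curvature of the restriction of `γ` to `[0, T]`: the integral, over its length, of
the norm of the second derivative of its parametrization by arc length. -/
def totalCurvature (γ : ℝ → E4) (T : ℝ) : ℝ :=
  ∫ s in (0 : ℝ)..arcLength γ T, ‖deriv (deriv (arcLengthParam γ)) s‖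

end ReebConvex

end

namespace ReebConvex

/-! ### Linear algebra of the frame `n, Jn, Mhat n, J (Mhat n)` -/

/-! Write `A` for the shape operator and `k = 2 / ⟪q, N⟫`. A Reeb orbit has velocity `k • J N`, so
its unit tangent is `J N` and its total curvature grows at the rate `k ‖A (J N)‖`
(`hasDerivAt_totalCurvature`). A solution of the linearized flow satisfies `w' = k • J (A w) + (dk
w) • J N`. Let `U` be its projection to the span of `M` and `J M`, the frame of the trivialization.
The polar angle of `U` in this frame grows at the rate `k (⟪A (J N), J N⟫ + ⟪A U, U⟫ / ‖U‖²)`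
(`rotation_form`, `hasDerivAt_angle`). The vectors `J N` and `U / ‖U‖` are orthonormal, so the
bracket is the trace of `A` on a tangent 2-plane. It is therefore at least `b + c ≥ a ≥ ‖A (J N)‖`
(`norm_le_of_pinching`). Integration bounds the total curvature by the rotation of any solution, and
Maslov index 3 puts every rotation strictly below `4π`. The analytic work is in
`IsReebFlow.linearized_equation`: joint smoothness of the flow is not assumed, so the equation for
`w` comes from a limit of difference quotients between nearby orbits. -/

theorem inner_E4 (u v : E4) :
    inner ℝ u v = u 0 * v 0 + u 1 * v 1 + u 2 * v 2 + u 3 * v 3 := by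
  simp [PiLp.inner_apply, Fin.sum_univ_four]; ring

theorem inner_J_right (u v : E4) : inner ℝ u (J v) = -inner ℝ (J u) v := by
  simp [inner_E4, J]; ring

theorem inner_J_self (u : E4) : inner ℝ u (J u) = 0 := by
  simp [inner_E4, J]; ring

theorem inner_J_J (u v : E4) : inner ℝ (J u) (J v) = inner ℝ u v := by
  simp [inner_E4, J]; ring

theorem J_J (u : E4) : J (J u) = -u := by
  ext i; fin_cases i <;> simp [J]

theorem norm_J (u : E4) : ‖J u‖ = ‖u‖ := by
  have := inner_J_J u u
  rw [real_inner_self_eq_norm_sq, real_inner_self_eq_norm_sq] at this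
  exact (sq_eq_sq₀ (norm_nonneg _) (norm_nonneg _)).1 this

theorem lambda0_eq_inner (p v : E4) : lambda0 p v = 1 / 2 * inner ℝ (J p) v := by
  simp [inner_E4, J, lambda0]; ring

theorem omega0_eq_inner (u v : E4) : omega0 u v = inner ℝ (J u) v := by
  simp [inner_E4, J, omega0]; ring

/-- `J` and `Mhat` are anticommuting orthogonal complex structures, so a unit vector and its images
form a quaternionic orthonormal frame; in coordinates everything reduces to `|n|² = 1`. -/
theorem frame_expansion {n : E4} (hn : ‖n‖ = 1) (v : E4) :
    v = inner ℝ n v • n + inner ℝ (J n) v • J n + inner ℝ (Mhat n) v • Mhat n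
      + inner ℝ (J (Mhat n)) v • J (Mhat n) := by
  have h : n 0 ^ 2 + n 1 ^ 2 + n 2 ^ 2 + n 3 ^ 2 = 1 := by
    have := EuclideanSpace.real_norm_sq_eq n
    rw [hn, Fin.sum_univ_four] at this
    linarith
  ext i; fin_cases i <;> simp [inner_E4, J, Mhat]
  · linear_combination -(v 0) * h
  · linear_combination -(v 1) * h
  · linear_combination -(v 2) * h
  · linear_combination -(v 3) * h

theorem frame_parseval {n : E4} (hn : ‖n‖ = 1) (v w : E4) :
    inner ℝ v w = inner ℝ n v * inner ℝ n w + inner ℝ (J n) v * inner ℝ (J n) w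
      + inner ℝ (Mhat n) v * inner ℝ (Mhat n) w
      + inner ℝ (J (Mhat n)) v * inner ℝ (J (Mhat n)) w := by
  conv_lhs => rw [frame_expansion hn v]
  simp only [inner_add_left, real_inner_smul_left]

/-- This and the next lemma measure how the frame turns: as `n` moves with tangential velocity `a`,
the frame vectors move with velocities `Mhat a` and `J (Mhat a)`. -/
theorem inner_Mhat_of_orthogonal {n a w : E4} (hn : ‖n‖ = 1) (ha : inner ℝ n a = 0)
    (hw : inner ℝ n w = 0) :
    inner ℝ (Mhat a) w = inner ℝ (J (Mhat n)) a * inner ℝ (J n) w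
      - inner ℝ (J n) a * inner ℝ (J (Mhat n)) w := by
  rw [frame_parseval hn (Mhat a) w, hw]
  have h1 : inner ℝ (J n) (Mhat a) = inner ℝ (J (Mhat n)) a := by
    simp [inner_E4, J, Mhat]; ring
  have h2 : inner ℝ (Mhat n) (Mhat a) = inner ℝ n a := by
    simp [inner_E4, Mhat]; ring
  have h3 : inner ℝ (J (Mhat n)) (Mhat a) = -inner ℝ (J n) a := by
    simp [inner_E4, J, Mhat]; ring
  rw [h1, h2, h3, ha]; ring

theorem inner_J_Mhat_of_orthogonal {n a w : E4} (hn : ‖n‖ = 1) (ha : inner ℝ n a = 0)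
    (hw : inner ℝ n w = 0) :
    inner ℝ (J (Mhat a)) w = inner ℝ (J n) a * inner ℝ (Mhat n) w
      - inner ℝ (Mhat n) a * inner ℝ (J n) w := by
  rw [frame_parseval hn (J (Mhat a)) w, hw]
  have h1 : inner ℝ (J n) (J (Mhat a)) = -inner ℝ (Mhat n) a := by
    simp [inner_E4, J, Mhat]; ring
  have h2 : inner ℝ (Mhat n) (J (Mhat a)) = inner ℝ (J n) a := by
    simp [inner_E4, J, Mhat]; ring
  have h3 : inner ℝ (J (Mhat n)) (J (Mhat a)) = inner ℝ n a := by
    simp [inner_E4, J, Mhat]; ring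
  rw [h1, h2, h3, ha]; ring

/-- The angular momentum of a solution of the linearized Reeb equation in the frame
`Mhat n, J (Mhat n)`, in terms of the shape operator. -/
theorem rotation_form {A : E4 →L[ℝ] E4} {n w : E4} (hn : ‖n‖ = 1) (hw : inner ℝ n w = 0)
    (hA : ∀ v, inner ℝ n v = 0 → inner ℝ n (A v) = 0) (k c : ℝ) :
    inner ℝ (Mhat n) w * (inner ℝ (J (Mhat (k • A (J n)))) w
        + inner ℝ (J (Mhat n)) (k • J (A w) + c • J n))
      - inner ℝ (J (Mhat n)) w * (inner ℝ (Mhat (k • A (J n))) w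
        + inner ℝ (Mhat n) (k • J (A w) + c • J n))
    = k * ((inner ℝ (Mhat n) w ^ 2 + inner ℝ (J (Mhat n)) w ^ 2) * inner ℝ (A (J n)) (J n)
        + inner ℝ (A (inner ℝ (Mhat n) w • Mhat n + inner ℝ (J (Mhat n)) w • J (Mhat n)))
          (inner ℝ (Mhat n) w • Mhat n + inner ℝ (J (Mhat n)) w • J (Mhat n))) := by
  have ha := hA (J n) (inner_J_self n)
  have h1 := inner_Mhat_of_orthogonal hn ha hw
  have h2 := inner_J_Mhat_of_orthogonal hn ha hw
  have h3 : inner ℝ (Mhat n) (J n) = 0 := by simp [inner_E4, J, Mhat]; ring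
  have h4 : inner ℝ (J (Mhat n)) (J n) = 0 := by simp [inner_E4, J, Mhat]; ring
  have h5 : inner ℝ (Mhat n) (J (A w)) = -inner ℝ (J (Mhat n)) (A w) := inner_J_right _ _
  have h6 : inner ℝ (J (Mhat n)) (J (A w)) = inner ℝ (Mhat n) (A w) := inner_J_J _ _
  -- The turning of the frame contributes exactly the `A (J n)` terms that replace `A w` by `A` of
  -- the projected vector, so symmetry of `A` is not needed. The `c • J n` term is orthogonal to the
  -- frame and drops out.
  have h7 : inner ℝ (Mhat n) w • Mhat n + inner ℝ (J (Mhat n)) w • J (Mhat n)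
      = w - inner ℝ (J n) w • J n := by
    have := frame_expansion hn w
    rw [hw, zero_smul, zero_add] at this
    rw [eq_sub_iff_add_eq]
    conv_rhs => rw [this]
    abel
  have h8 : inner ℝ (A (inner ℝ (Mhat n) w • Mhat n + inner ℝ (J (Mhat n)) w • J (Mhat n)))
          (inner ℝ (Mhat n) w • Mhat n + inner ℝ (J (Mhat n)) w • J (Mhat n))
      = inner ℝ (Mhat n) w * inner ℝ (Mhat n) (A w - inner ℝ (J n) w • A (J n))
       + inner ℝ (J (Mhat n)) w * inner ℝ (J (Mhat n)) (A w - inner ℝ (J n) w • A (J n)) := by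
    nth_rw 1 [h7]
    rw [map_sub, map_smul, real_inner_comm, inner_add_left, real_inner_smul_left,
      real_inner_smul_left]
  rw [h8]
  simp only [map_smul, real_inner_smul_left, inner_add_right, real_inner_smul_right, h1, h2, h3,
    h4, h5, h6, inner_sub_right]
  rw [real_inner_comm (J n) (A (J n))]
  ring

/-- The sum of the second fundamental forms in two orthonormal directions controls the norm of the
shape operator in the first one, if `a ≤ b + c`. -/
theorem norm_le_of_pinching {A : E4 →L[ℝ] E4} {n : E4} (hn : ‖n‖ = 1) {a b c : ℝ}
    (hba : b ≤ a) (hcb : c ≤ b) (habc : a ≤ b + c) {e : Fin 3 → E4} (he : Orthonormal ℝ e)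
    (hen : ∀ i, inner ℝ n (e i) = 0)
    (hA : ∀ i, A (e i) = (![a, b, c] : Fin 3 → ℝ) i • e i) {v u : E4} (hv : ‖v‖ = 1)
    (hnv : inner ℝ n v = 0) (hnu : inner ℝ n u = 0) (hvu : inner ℝ v u = 0) :
    ‖u‖ ^ 2 * ‖A v‖ ≤ ‖u‖ ^ 2 * inner ℝ (A v) v + inner ℝ (A u) u := by
  -- Adding the normal to the principal directions gives a basis of the whole space, in which
  -- tangent vectors have only the three principal coordinates.
  obtain ⟨B, hB⟩ : ∃ B : OrthonormalBasis (Fin 4) ℝ E4, ∀ i, B i = (Fin.cons n e : Fin 4 → E4) i := by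
    have ho : Orthonormal ℝ (Fin.cons n e : Fin 4 → E4) := by
      rw [orthonormal_iff_ite] at he ⊢
      intro i j
      refine Fin.cases ?_ (fun i => ?_) i <;> refine Fin.cases ?_ (fun j => ?_) j
      · simp [hn]
      · simp [hen, (Fin.succ_ne_zero _).symm]
      · simp only [Fin.cons_succ, Fin.cons_zero, Fin.succ_ne_zero, if_false]
        rw [real_inner_comm, hen]
      · simp [he]
    obtain ⟨B, hB⟩ := Orthonormal.exists_orthonormalBasis_extension_of_card_eq (𝕜 := ℝ) (E := E4)
      (ι := Fin 4) (by simp) (v := Fin.cons n e) (s := univ)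
      (Orthonormal.comp ho (fun i : (univ : Set (Fin 4)) => i.1) Subtype.val_injective)
    exact ⟨B, fun i => hB i (mem_univ i)⟩
  have hpar : ∀ x y : E4, inner ℝ n x = 0 → inner ℝ x y = inner ℝ (e 0) x * inner ℝ (e 0) y
      + inner ℝ (e 1) x * inner ℝ (e 1) y + inner ℝ (e 2) x * inner ℝ (e 2) y := by
    intro x y hx
    rw [← B.sum_inner_mul_inner x y, Fin.sum_univ_succ, Fin.sum_univ_three]
    simp only [hB, Fin.cons_zero, Fin.cons_succ, real_inner_comm n x, hx, real_inner_comm _ x]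
    ring
  have hexp : ∀ x : E4, inner ℝ n x = 0 → x = inner ℝ (e 0) x • e 0 + inner ℝ (e 1) x • e 1
      + inner ℝ (e 2) x • e 2 := by
    intro x hx
    have := B.sum_repr' x
    rw [Fin.sum_univ_succ, Fin.sum_univ_three] at this
    simp only [hB, Fin.cons_zero, Fin.cons_succ, hx] at this
    rw [zero_smul, zero_add] at this
    exact this.symm
  have hAe : ∀ x : E4, inner ℝ n x = 0 → A x = (a * inner ℝ (e 0) x) • e 0
      + (b * inner ℝ (e 1) x) • e 1 + (c * inner ℝ (e 2) x) • e 2 := by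
    intro x hx
    conv_lhs => rw [hexp x hx]
    simp only [map_add, map_smul, hA, smul_smul]
    simp [mul_comm]
  have hAin : ∀ x y : E4, inner ℝ n x = 0 → inner ℝ (A x) y
      = a * inner ℝ (e 0) x * inner ℝ (e 0) y + b * inner ℝ (e 1) x * inner ℝ (e 1) y
        + c * inner ℝ (e 2) x * inner ℝ (e 2) y := by
    intro x y hx
    rw [hAe x hx]
    simp only [inner_add_left, real_inner_smul_left]
  have hee : ∀ i j, inner ℝ (e i) (e j) = if i = j then (1 : ℝ) else 0 :=
    orthonormal_iff_ite.1 he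
  have hAe' : ∀ x : E4, inner ℝ n x = 0 → ‖A x‖ ^ 2 = a ^ 2 * inner ℝ (e 0) x ^ 2
      + b ^ 2 * inner ℝ (e 1) x ^ 2 + c ^ 2 * inner ℝ (e 2) x ^ 2 := by
    intro x hx
    rw [← real_inner_self_eq_norm_sq, hAin x _ hx, hAe x hx]
    simp only [inner_add_right, real_inner_smul_right, hee]
    simp; ring
  have hvv := hpar v v hnv
  have huu := hpar u u hnu
  rw [hpar v u hnv] at hvu
  rw [real_inner_self_eq_norm_sq] at hvv huu
  rw [hAin v v hnv, hAin u u hnu]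
  have hAv := hAe' v hnv
  rw [hv] at hvv
  generalize inner ℝ (e 0) v = x0 at *
  generalize inner ℝ (e 1) v = x1 at *
  generalize inner ℝ (e 2) v = x2 at *
  generalize inner ℝ (e 0) u = y0 at *
  generalize inner ℝ (e 1) u = y1 at *
  generalize inner ℝ (e 2) u = y2 at *
  -- Nonnegativity comes from the pinching alone: `b ≤ a ≤ b + c`.
  have hc : 0 ≤ c := by linarith
  have hb : 0 ≤ b := by linarith
  have ha : ‖A v‖ ≤ a := by
    refine abs_le_of_sq_le_sq' ?_ (by linarith) |>.2
    rw [hAv]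
    have h1 : b ^ 2 ≤ a ^ 2 := by nlinarith
    have h2 : c ^ 2 ≤ a ^ 2 := by nlinarith
    nlinarith [mul_le_mul_of_nonneg_right h1 (sq_nonneg x1),
      mul_le_mul_of_nonneg_right h2 (sq_nonneg x2)]
  set R := ‖u‖ ^ 2
  have hR : 0 ≤ R := sq_nonneg _
  -- Bessel's inequality for the orthogonal vectors `v` and `u`
  have bessel : ∀ x0 x1 x2 y0 y1 y2 : ℝ, (1:ℝ) = x0 * x0 + x1 * x1 + x2 * x2 →
      R = y0 * y0 + y1 * y1 + y2 * y2 → x0 * y0 + x1 * y1 + x2 * y2 = 0 →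
      R * x0 ^ 2 + y0 ^ 2 ≤ R := by
    intro x0 x1 x2 y0 y1 y2 h1 h2 h3
    have : R - R * x0 ^ 2 - y0 ^ 2 = (x1 * y2 - x2 * y1) ^ 2 := by
      linear_combination (R - y0 ^ 2) * h1 + (x1 ^ 2 + x2 ^ 2) * h2
        - (x0 * y0 - (x1 * y1 + x2 * y2)) * h3
    nlinarith [sq_nonneg (x1 * y2 - x2 * y1)]
  have p1 : R * x1 ^ 2 + y1 ^ 2 ≤ R :=
    bessel x1 x0 x2 y1 y0 y2 (by linarith) (by linarith) (by linarith)
  have p2 : R * x2 ^ 2 + y2 ^ 2 ≤ R :=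
    bessel x2 x0 x1 y2 y0 y1 (by linarith) (by linarith) (by linarith)
  have p0 : 0 ≤ R * x0 ^ 2 + y0 ^ 2 := by positivity
  -- The right-hand side of the goal is `a p₀ + b p₁ + c p₂` with weights `pᵢ = R xᵢ² + yᵢ²` of sum
  -- `2R`. Since `p₀ ≥ 0` and `p₂ ≤ R`, it is at least `b (2R - p₂) + c p₂ ≥ (b + c) R`.
  have hsum : (R * x0 ^ 2 + y0 ^ 2) + (R * x1 ^ 2 + y1 ^ 2) + (R * x2 ^ 2 + y2 ^ 2) = 2 * R := by
    linear_combination -R * hvv - huu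
  have q0 := mul_le_mul_of_nonneg_right hba p0
  have q2 := mul_le_mul_of_nonneg_right hcb (sub_nonneg.2 p2)
  have q := mul_le_mul_of_nonneg_left (ha.trans habc) hR
  nlinarith [congrArg (fun z => b * z) hsum]

open Filter

variable {C : Set E4}

/-! ### The normal field of a smooth boundary -/

theorem mem_tangent_iff {q v : E4} : v ∈ tangent C q ↔ inner ℝ (N C q) v = 0 :=
  Submodule.mem_orthogonal_singleton_iff_inner_right

/-- The derivative of a defining function along a ray from `q` fixes its sign for small positive
times. -/
theorem eventually_mem_of_isOuterUnitNormal {q k : E4} (h : IsOuterUnitNormal C q k) (w : E4) :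
    (inner ℝ k w < 0 → ∀ᶠ t in 𝓝[>] (0 : ℝ), q + t • w ∈ C) ∧
    (0 < inner ℝ k w → ∀ᶠ t in 𝓝[>] (0 : ℝ), q + t • w ∉ C) := by
  obtain ⟨ρ, ⟨U, hU, hqU, hρ, h0, hg, hC⟩, rfl⟩ := h
  have hd : DifferentiableAt ℝ ρ q :=
    (hρ.contDiffAt (hU.mem_nhds hqU)).differentiableAt (by simp)
  have hline : HasDerivAt (fun t : ℝ => q + t • w) w 0 := by
    simpa using ((hasDerivAt_id (0 : ℝ)).smul_const w).const_add q
  have hcomp : HasDerivAt (fun t : ℝ => ρ (q + t • w)) (inner ℝ (gradient ρ q) w) 0 := by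
    have h1 : HasFDerivAt ρ (fderiv ℝ ρ q) (q + (0 : ℝ) • w) := by
      simpa using hd.hasFDerivAt
    rw [inner_gradient_left]
    exact h1.comp_hasDerivAt (0 : ℝ) hline
  have hUev : ∀ᶠ t in 𝓝[>] (0 : ℝ), q + t • w ∈ U := by
    refine (hline.continuousAt.eventually_mem (hU.mem_nhds ?_)).filter_mono nhdsWithin_le_nhds
    simpa using hqU
  have hpos : 0 < ‖gradient ρ q‖⁻¹ := inv_pos.2 (norm_pos_iff.2 hg)
  have hsl := hcomp.hasDerivWithinAt (s := Ioi 0)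
  rw [hasDerivWithinAt_iff_tendsto_slope' (by simp)] at hsl
  rw [real_inner_smul_left]
  constructor
  · intro hw
    have hw' : inner ℝ (gradient ρ q) w < 0 := by
      by_contra hh; exact absurd hw (not_lt.2 (mul_nonneg hpos.le (not_lt.1 hh)))
    filter_upwards [hUev, hsl.eventually_lt_const hw', self_mem_nhdsWithin] with t h1 h2 h3
    rw [hC _ h1]
    simp [slope, h0] at h2
    have h3' : (0 : ℝ) < t⁻¹ := inv_pos.2 h3
    nlinarith
  · intro hw
    have hw' : 0 < inner ℝ (gradient ρ q) w := pos_of_mul_pos_right hw hpos.le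
    filter_upwards [hUev, hsl.eventually_const_lt hw', self_mem_nhdsWithin] with t h1 h2 h3
    rw [hC _ h1]
    simp [slope, h0] at h2
    have h3' : (0 : ℝ) < t⁻¹ := inv_pos.2 h3
    intro h4
    nlinarith

theorem norm_N (hs : HasSmoothBoundary C) {q : E4} (hq : q ∈ frontier C) : ‖N C q‖ = 1 :=
  isOuterUnitNormal_norm (isOuterUnitNormal_N hs hq)

/-- The support function of a convex set is positive if the origin is an interior point. -/
theorem inner_N_pos (hcl : IsClosed C) (hconv : Convex ℝ C) (h0 : (0 : E4) ∈ interior C)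
    (hs : HasSmoothBoundary C) {q : E4} (hq : q ∈ frontier C) : 0 < inner ℝ q (N C q) := by
  have hN := isOuterUnitNormal_N hs hq
  have hN1 := isOuterUnitNormal_norm hN
  by_contra hle
  push Not at hle
  have hlim : Tendsto (fun r : ℝ => r • N C q) (𝓝[>] 0) (𝓝 (0 : E4)) := by
    have : Continuous (fun r : ℝ => r • N C q) := by fun_prop
    have h := this.tendsto 0
    rw [zero_smul] at h
    exact h.mono_left nhdsWithin_le_nhds
  -- If the support function were nonpositive, the segment from `q` to the point `r • N` of `C`
  -- would leave `q` in an outward direction, yet convexity keeps it in `C`.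
  obtain ⟨r, hr, hr0⟩ := ((hlim.eventually (mem_interior_iff_mem_nhds.1 h0)).and
    self_mem_nhdsWithin).exists
  have hr0 : 0 < r := hr0
  have h1 : 0 < inner ℝ (N C q) (r • N C q - q) := by
    rw [inner_sub_right, real_inner_smul_right, real_inner_self_eq_norm_sq, hN1,
      real_inner_comm q (N C q)]
    linarith
  have h2 : ∀ᶠ t in 𝓝[>] (0 : ℝ), t < 1 := nhdsWithin_le_nhds (gt_mem_nhds one_pos)
  obtain ⟨t, ⟨ht1, ht2⟩, ht3⟩ := (((eventually_mem_of_isOuterUnitNormal hN _).2 h1).and h2 |>.and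
    self_mem_nhdsWithin).exists
  have ht3 : 0 < t := ht3
  refine ht1 ?_
  have hqC : q ∈ C := hcl.frontier_subset hq
  have := hconv hqC hr (a := 1 - t) (b := t) (by linarith) ht3.le (by ring)
  convert this using 1
  module

theorem eq_zero_of_mem_frontier (hcl : IsClosed C) {U : Set E4} {ρ : E4 → ℝ} (hU : IsOpen U)
    (hρ : ContDiffOn ℝ ∞ ρ U) (hC : ∀ x ∈ U, x ∈ C ↔ ρ x ≤ 0) {x : E4} (hxU : x ∈ U)
    (hx : x ∈ frontier C) : ρ x = 0 := by
  refine le_antisymm ((hC x hxU).1 (hcl.frontier_subset hx)) (not_lt.1 fun hlt => ?_)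
  refine hx.2 (mem_interior_iff_mem_nhds.2 ?_)
  have hcont : ContinuousAt ρ x := (hρ.continuousOn.continuousAt (hU.mem_nhds hxU))
  filter_upwards [hU.mem_nhds hxU, hcont.eventually_lt_const hlt] with y h1 h2
  exact (hC y h1).2 h2.le

theorem contDiffAt_gradient {U : Set E4} {ρ : E4 → ℝ} (hU : IsOpen U)
    (hρ : ContDiffOn ℝ ∞ ρ U) {x : E4} (hx : x ∈ U) : ContDiffAt ℝ ∞ (gradient ρ) x := by
  rw [contDiffAt_euclidean]
  intro i
  have h : (fun y => gradient ρ y i) = fun y => fderiv ℝ ρ y (EuclideanSpace.single i 1) := by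
    funext y
    rw [← inner_gradient_left, EuclideanSpace.inner_single_right]
    simp
  rw [h]
  have h1 : ContDiffAt ℝ ∞ (fderiv ℝ ρ) x :=
    (hρ.contDiffAt (hU.mem_nhds hx)).fderiv_right (by simp)
  exact h1.clm_apply contDiffAt_const

/-- The normal field of a smooth boundary is locally the restriction of a smooth map. -/
theorem exists_local_extension_N (hcl : IsClosed C) (hs : HasSmoothBoundary C) {q : E4}
    (hq : q ∈ frontier C) :
    ∃ (G : E4 → E4) (V : Set E4), IsOpen V ∧ q ∈ V ∧ ContDiffOn ℝ ∞ G V ∧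
      ∀ x ∈ V, x ∈ frontier C → N C x = G x := by
  obtain ⟨ρ, U, hU, hqU, hρ, h0, hg, hC⟩ := hs q hq
  have hopen : IsOpen (U ∩ gradient ρ ⁻¹' {0}ᶜ) :=
    ContinuousOn.isOpen_inter_preimage
      (fun x hx => (contDiffAt_gradient hU hρ hx).continuousAt.continuousWithinAt) hU
      isOpen_compl_singleton
  refine ⟨fun x => ‖gradient ρ x‖⁻¹ • gradient ρ x, U ∩ gradient ρ ⁻¹' {0}ᶜ, hopen, ⟨hqU, hg⟩,
    ?_, ?_⟩
  · rintro x ⟨hxU, hx⟩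
    have h1 := contDiffAt_gradient hU hρ hxU
    exact (((h1.norm ℝ hx).inv (norm_ne_zero_iff.2 hx)).smul h1).contDiffWithinAt
  · rintro x ⟨hxU, hx⟩ hxf
    exact isOuterUnitNormal_unique (isOuterUnitNormal_N hs hxf)
      ⟨ρ, ⟨U, hU, hxU, hρ, eq_zero_of_mem_frontier hcl hU hρ hC hxU hxf, hx, hC⟩, rfl⟩

/-- Every tangent vector is the limit of difference quotients of boundary points. -/
theorem exists_seq_of_mem_tangent (hcl : IsClosed C) (hs : HasSmoothBoundary C) {q v : E4}
    (hq : q ∈ frontier C) (hv : v ∈ tangent C q) :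
    ∃ (c : ℕ → ℝ) (d : ℕ → E4), Tendsto d atTop (𝓝 0) ∧ (∀ m, q + d m ∈ frontier C) ∧
      Tendsto (fun m => c m • d m) atTop (𝓝 v) := by
  have hN := isOuterUnitNormal_N hs hq
  have hN1 := isOuterUnitNormal_norm hN
  rw [mem_tangent_iff] at hv
  have key : ∀ m : ℕ, ∃ ε τ : ℝ, 0 < ε ∧ ε < 1 / ((m : ℝ) + 1) ∧ |τ| ≤ 1 / ((m : ℝ) + 1) ∧
      q + ε • (v + τ • N C q) ∈ frontier C := by
    intro m
    set δ : ℝ := 1 / ((m : ℝ) + 1)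
    have hδ : 0 < δ := by positivity
    have h1 := (eventually_mem_of_isOuterUnitNormal hN (v + (-δ) • N C q)).1 (by
      rw [inner_add_right, real_inner_smul_right, real_inner_self_eq_norm_sq, hN1, hv]; linarith)
    have h2 := (eventually_mem_of_isOuterUnitNormal hN (v + δ • N C q)).2 (by
      rw [inner_add_right, real_inner_smul_right, real_inner_self_eq_norm_sq, hN1, hv]; linarith)
    have h3 : ∀ᶠ t in 𝓝[>] (0 : ℝ), t < δ := nhdsWithin_le_nhds (gt_mem_nhds hδ)
    obtain ⟨ε, ⟨⟨he1, he2⟩, he3⟩, he4⟩ := ((h1.and h2).and h3 |>.and self_mem_nhdsWithin).exists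
    refine ⟨ε, ?_⟩
    by_contra hcon
    push Not at hcon
    have hf : Continuous fun τ : ℝ => q + ε • (v + τ • N C q) := by fun_prop
    -- Tilting `v` inward by `δ` lands in `C` and tilting it outward lands outside. A connected
    -- family of tilts that missed the boundary would be split by the interior and the complement.
    obtain ⟨τ, -, hτ1, hτ2⟩ := isPreconnected_Icc (a := -δ) (b := δ)
      ((fun τ : ℝ => q + ε • (v + τ • N C q)) ⁻¹' interior C)
      ((fun τ : ℝ => q + ε • (v + τ • N C q)) ⁻¹' Cᶜ)
      (isOpen_interior.preimage hf) (hcl.isOpen_compl.preimage hf) (by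
        intro τ hτ
        have h := hcon τ he4 he3 (abs_le.2 hτ)
        by_cases hmem : q + ε • (v + τ • N C q) ∈ C
        · left
          by_contra hint
          exact h ⟨subset_closure hmem, hint⟩
        · exact Or.inr hmem)
      ⟨-δ, ⟨le_rfl, by linarith⟩, by
        by_contra hint
        exact hcon (-δ) he4 he3 (by rw [abs_neg, abs_of_pos hδ]) ⟨subset_closure he1, hint⟩⟩
      ⟨δ, ⟨by linarith, le_rfl⟩, he2⟩
    exact hτ2 (interior_subset hτ1)
  choose ε τ h1 h2 h3 h4 using key
  have hε : Tendsto ε atTop (𝓝 0) :=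
    squeeze_zero (fun m => (h1 m).le) (fun m => (h2 m).le) tendsto_one_div_add_atTop_nhds_zero_nat
  have hτ : Tendsto τ atTop (𝓝 0) :=
    squeeze_zero_norm h3 tendsto_one_div_add_atTop_nhds_zero_nat
  have hlim : Tendsto (fun m => v + τ m • N C q) atTop (𝓝 v) := by
    simpa using (hτ.smul_const (N C q)).const_add v
  refine ⟨fun m => (ε m)⁻¹, fun m => ε m • (v + τ m • N C q), ?_, h4, ?_⟩
  · simpa using hε.smul hlim
  · refine hlim.congr fun m => ?_
    rw [smul_smul, inv_mul_cancel₀ (h1 m).ne', one_smul]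

/-- Limits of difference quotients of boundary points are tangent vectors. -/
theorem mem_tangent_of_tendsto (hcl : IsClosed C) (hs : HasSmoothBoundary C) {q v : E4}
    (hq : q ∈ frontier C) {c : ℕ → ℝ} {d : ℕ → E4} (hd : Tendsto d atTop (𝓝 0))
    (hm : ∀ m, q + d m ∈ frontier C) (hv : Tendsto (fun m => c m • d m) atTop (𝓝 v)) :
    v ∈ tangent C q := by
  obtain ⟨ρ, ⟨U, hU, hqU, hρ, h0, hg, hC⟩, hN⟩ := isOuterUnitNormal_N hs hq
  rw [mem_tangent_iff, hN, real_inner_smul_left, inner_gradient_left]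
  have hdiff : DifferentiableAt ℝ ρ q :=
    (hρ.contDiffAt (hU.mem_nhds hqU)).differentiableAt (by simp)
  have hlim := hdiff.hasFDerivAt.hasFDerivWithinAt.lim (s := univ) hd (by simp) hv
  have hqd : Tendsto (fun m => q + d m) atTop (𝓝 q) := by simpa using hd.const_add q
  have hzero : Tendsto (fun m => c m • (ρ (q + d m) - ρ q)) atTop (𝓝 0) := by
    refine tendsto_const_nhds.congr' ?_
    filter_upwards [hqd.eventually (hU.mem_nhds hqU)] with m hmU
    rw [eq_zero_of_mem_frontier hcl hU hρ hC hmU (hm m), h0]; simp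
  rw [tendsto_nhds_unique hlim hzero, mul_zero]

/-- Derivatives along the boundary are determined on tangent vectors. -/
theorem hasFDerivWithinAt_unique_of_mem_tangent {F : Type*} [NormedAddCommGroup F]
    [NormedSpace ℝ F] (hcl : IsClosed C)
    (hs : HasSmoothBoundary C) {q v : E4} (hq : q ∈ frontier C) (hv : v ∈ tangent C q)
    {f : E4 → F} {f₁ f₂ : E4 →L[ℝ] F} (h₁ : HasFDerivWithinAt f f₁ (frontier C) q)
    (h₂ : HasFDerivWithinAt f f₂ (frontier C) q) : f₁ v = f₂ v := by
  obtain ⟨c, d, hd, hm, hcd⟩ := exists_seq_of_mem_tangent hcl hs hq hv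
  exact tendsto_nhds_unique (h₁.lim hd (Eventually.of_forall hm) hcd)
    (h₂.lim hd (Eventually.of_forall hm) hcd)

/-! ### The shape operator -/

theorem hasFDerivWithinAt_N (hcl : IsClosed C) (hs : HasSmoothBoundary C) {q : E4}
    (hq : q ∈ frontier C) :
    HasFDerivWithinAt (N C) (shapeOperator C q) (frontier C) q := by
  obtain ⟨G, V, hV, hqV, hG, hNG⟩ := exists_local_extension_N hcl hs hq
  have hd : DifferentiableAt ℝ G q :=
    (hG.contDiffAt (hV.mem_nhds hqV)).differentiableAt (by simp)
  have : DifferentiableWithinAt ℝ (N C) (frontier C) q := by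
    refine hd.differentiableWithinAt.congr_of_eventuallyEq ?_ (hNG q hqV hq)
    filter_upwards [self_mem_nhdsWithin, nhdsWithin_le_nhds (hV.mem_nhds hqV)] with x h1 h2
    exact hNG x h2 h1
  exact this.hasFDerivWithinAt

/-- `fderivWithin` on a hypersurface is a choice in the normal direction, so agreement with a smooth
extension holds only on tangent vectors. Continuity of `A` is likewise available only along tangent
fields. -/
theorem shapeOperator_eq_fderiv (hcl : IsClosed C) (hs : HasSmoothBoundary C) {G : E4 → E4}
    {V : Set E4} (hV : IsOpen V) (hG : ContDiffOn ℝ ∞ G V)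
    (hNG : ∀ x ∈ V, x ∈ frontier C → N C x = G x) {q v : E4} (hqV : q ∈ V)
    (hq : q ∈ frontier C) (hv : v ∈ tangent C q) : shapeOperator C q v = fderiv ℝ G q v := by
  have hd : DifferentiableAt ℝ G q :=
    (hG.contDiffAt (hV.mem_nhds hqV)).differentiableAt (by simp)
  refine hasFDerivWithinAt_unique_of_mem_tangent hcl hs hq hv (hasFDerivWithinAt_N hcl hs hq)
    (hd.hasFDerivAt.hasFDerivWithinAt.congr_of_eventuallyEq ?_ (hNG q hqV hq))
  filter_upwards [self_mem_nhdsWithin, nhdsWithin_le_nhds (hV.mem_nhds hqV)] with x h1 h2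
  exact hNG x h2 h1

/-- Differentiate `⟪N, N⟫ = 1` along the boundary. -/
theorem shapeOperator_mem_tangent (hcl : IsClosed C) (hs : HasSmoothBoundary C) {q v : E4}
    (hq : q ∈ frontier C) (hv : v ∈ tangent C q) : shapeOperator C q v ∈ tangent C q := by
  have h := hasFDerivWithinAt_N hcl hs hq
  have h1 := h.inner ℝ h
  have h2 : HasFDerivWithinAt (fun x => inner ℝ (N C x) (N C x)) (0 : E4 →L[ℝ] ℝ)
      (frontier C) q := by
    refine (hasFDerivWithinAt_const (1 : ℝ) q (frontier C)).congr (fun x hx => ?_) ?_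
    · rw [real_inner_self_eq_norm_sq, norm_N hs hx, one_pow]
    · rw [real_inner_self_eq_norm_sq, norm_N hs hq, one_pow]
  have h3 := hasFDerivWithinAt_unique_of_mem_tangent hcl hs hq hv h1 h2
  simp [fderivInnerCLM_apply, real_inner_comm (N C q)] at h3
  exact mem_tangent_iff.2 h3

theorem continuousOn_N (hcl : IsClosed C) (hs : HasSmoothBoundary C) :
    ContinuousOn (N C) (frontier C) :=
  fun _ hq => (hasFDerivWithinAt_N hcl hs hq).continuousWithinAt

theorem continuousOn_shapeOperator (hcl : IsClosed C) (hs : HasSmoothBoundary C) {S : Set ℝ}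
    {γ w : ℝ → E4} (hγ : ContinuousOn γ S) (hw : ContinuousOn w S)
    (hγC : ∀ t ∈ S, γ t ∈ frontier C) (hwC : ∀ t ∈ S, w t ∈ tangent C (γ t)) :
    ContinuousOn (fun t => shapeOperator C (γ t) (w t)) S := by
  intro t ht
  obtain ⟨G, V, hV, hqV, hG, hNG⟩ := exists_local_extension_N hcl hs (hγC t ht)
  have hfd : ContinuousAt (fderiv ℝ G) (γ t) :=
    ((hG.contDiffAt (hV.mem_nhds hqV)).fderiv_right (m := ∞) (by simp)).continuousAt
  have h1 : ContinuousWithinAt (fun t => fderiv ℝ G (γ t) (w t)) S t :=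
    (hfd.comp_continuousWithinAt (hγ t ht)).clm_apply (hw t ht)
  refine h1.congr_of_eventuallyEq ?_
    (shapeOperator_eq_fderiv hcl hs hV hG hNG hqV (hγC t ht) (hwC t ht))
  filter_upwards [self_mem_nhdsWithin, (hγ t ht).eventually (hV.mem_nhds hqV)] with s h2 h3
  exact shapeOperator_eq_fderiv hcl hs hV hG hNG h3 (hγC s h2) (hwC s h2)

/-! ### The Reeb vector field -/

/-- The length of the Reeb vector. -/
noncomputable def reebSpeed (C : Set E4) (q : E4) : ℝ := 2 / inner ℝ q (N C q)

/-- The Reeb vector field on the boundary of `C`. -/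
noncomputable def reebField (C : Set E4) (q : E4) : E4 := reebSpeed C q • J (N C q)

/-- The condition on `dλ` makes `J w` orthogonal to the tangent space, hence a multiple of `N`; the
condition `λ(w) = 1` fixes the factor. -/
theorem IsReebVector.eq_reebField {q w : E4} (h : IsReebVector C q w) : w = reebField C q := by
  obtain ⟨h1, h2, h3⟩ := h
  have h4 : J w ∈ (tangent C q)ᗮ := by
    rw [Submodule.mem_orthogonal]
    intro u hu
    rw [real_inner_comm, ← omega0_eq_inner]
    exact h3 u hu
  rw [tangent, Submodule.orthogonal_orthogonal, Submodule.mem_span_singleton] at h4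
  obtain ⟨r, hr⟩ := h4
  have h5 : w = (-r) • J (N C q) := by
    rw [neg_smul, ← map_smul, hr, J_J, neg_neg]
  rw [h5, lambda0_eq_inner, real_inner_smul_right, inner_J_J] at h2
  rw [h5, reebField, reebSpeed]
  congr 1
  have h6 : inner ℝ q (N C q) ≠ 0 := by
    intro h; rw [h] at h2; simp at h2
  field_simp
  linarith

theorem J_N_mem_tangent (q : E4) : J (N C q) ∈ tangent C q :=
  mem_tangent_iff.2 (inner_J_self _)

/-- The derivative of the length of the Reeb vector. -/
noncomputable def reebSpeedDeriv (C : Set E4) (q w : E4) : ℝ :=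
  -2 * (inner ℝ q (shapeOperator C q w) + inner ℝ w (N C q)) / inner ℝ q (N C q) ^ 2

theorem exists_hasFDerivWithinAt_reebField (hcl : IsClosed C) (hs : HasSmoothBoundary C) {q : E4}
    (hq : q ∈ frontier C) (hpos : 0 < inner ℝ q (N C q)) :
    ∃ D : E4 →L[ℝ] E4, HasFDerivWithinAt (reebField C) D (frontier C) q ∧
      ∀ w, D w = reebSpeed C q • J (shapeOperator C q w) + reebSpeedDeriv C q w • J (N C q) := by
  have hN := hasFDerivWithinAt_N hcl hs hq
  have h1 := (hasFDerivWithinAt_id q (frontier C)).inner ℝ hN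
  have h2 := (((hasDerivAt_inv hpos.ne').comp_hasFDerivWithinAt q h1).const_mul 2)
  have h3 : HasFDerivWithinAt (fun x => J (N C x))
      (J.toContinuousLinearMap.comp (shapeOperator C q)) (frontier C) q :=
    J.toContinuousLinearMap.hasFDerivAt.comp_hasFDerivWithinAt q hN
  refine ⟨_, h2.smul h3, fun w => ?_⟩
  simp [reebSpeed, reebSpeedDeriv, fderivInnerCLM_apply, div_eq_mul_inv]
  ring_nf

/-- Local smooth extensions give local Lipschitz bounds, and compactness makes them global. The
constant feeds the Grönwall estimate for nearby orbits. -/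
theorem exists_lipschitzOnWith_reebField (hC : IsCompact C) (hs : HasSmoothBoundary C)
    (hpos : ∀ q ∈ frontier C, 0 < inner ℝ q (N C q)) :
    ∃ K, LipschitzOnWith K (reebField C) (frontier C) := by
  refine LocallyLipschitzOn.exists_lipschitzOnWith_of_compact
    (hC.of_isClosed_subset isClosed_frontier hC.isClosed.frontier_subset) ?_
  intro q hq
  obtain ⟨G, V, hV, hqV, hG, hNG⟩ := exists_local_extension_N hC.isClosed hs hq
  have hG1 := hG.contDiffAt (hV.mem_nhds hqV)
  have hX : ContDiffAt ℝ 1 (fun x => (2 / inner ℝ x (G x)) • J.toContinuousLinearMap (G x)) q := by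
    have h1 : ContDiffAt ℝ ∞ (fun x => inner ℝ x (G x)) q := contDiffAt_id.inner ℝ hG1
    have h2 : ContDiffAt ℝ ∞ (fun x => J.toContinuousLinearMap (G x)) q :=
      J.toContinuousLinearMap.contDiff.contDiffAt.comp q hG1
    have h3 := hpos q hq
    rw [hNG q hqV hq] at h3
    exact ((contDiffAt_const.div h1 h3.ne').smul h2).of_le (by simp)
  obtain ⟨K, t, ht, hK⟩ := hX.exists_lipschitzOnWith
  refine ⟨K, frontier C ∩ (t ∩ V),
    inter_mem_nhdsWithin _ (inter_mem ht (hV.mem_nhds hqV)), ?_⟩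
  intro x hx y hy
  have := hK hx.2.1 hy.2.1
  simp only [reebField, reebSpeed, hNG x hx.2.2 hx.1, hNG y hy.2.2 hy.1]
  exact this

/-! ### The linearized Reeb flow -/

theorem IsReebFlow.hasDerivAt {Ψ : ℝ → E4 → E4} (hΨ : IsReebFlow C Ψ) {q : E4}
    (hq : q ∈ frontier C) (t : ℝ) :
    HasDerivAt (fun s => Ψ s q) (reebField C (Ψ t q)) t := by
  obtain ⟨-, w, hw, h⟩ := (hΨ q hq).2 t
  rwa [hw.eq_reebField] at h

theorem IsReebFlow.mem_frontier {Ψ : ℝ → E4 → E4} (hΨ : IsReebFlow C Ψ) {q : E4}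
    (hq : q ∈ frontier C) (t : ℝ) : Ψ t q ∈ frontier C := ((hΨ q hq).2 t).1

theorem IsReebFlow.continuous {Ψ : ℝ → E4 → E4} (hΨ : IsReebFlow C Ψ) {q : E4}
    (hq : q ∈ frontier C) : Continuous fun s => Ψ s q :=
  continuous_iff_continuousAt.2 fun t => (hΨ.hasDerivAt hq t).continuousAt

/-- The right-hand side of the linearization of the Reeb equation. -/
noncomputable def linearizedField (C : Set E4) (q w : E4) : E4 :=
  reebSpeed C q • J (shapeOperator C q w) + reebSpeedDeriv C q w • J (N C q)

theorem continuousOn_linearizedField (hcl : IsClosed C) (hs : HasSmoothBoundary C)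
    (hpos : ∀ q ∈ frontier C, 0 < inner ℝ q (N C q)) {S : Set ℝ}
    {γ w : ℝ → E4} (hγ : ContinuousOn γ S) (hw : ContinuousOn w S)
    (hγC : ∀ t ∈ S, γ t ∈ frontier C) (hwC : ∀ t ∈ S, w t ∈ tangent C (γ t)) :
    ContinuousOn (fun t => linearizedField C (γ t) (w t)) S := by
  have hA := continuousOn_shapeOperator hcl hs hγ hw hγC hwC
  have hN : ContinuousOn (fun t => N C (γ t)) S := (continuousOn_N hcl hs).comp hγ hγC
  have hJ : Continuous J := J.continuous_of_finiteDimensional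
  have hne : ∀ t ∈ S, inner ℝ (γ t) (N C (γ t)) ≠ 0 := fun t ht => (hpos _ (hγC t ht)).ne'
  have h1 := hγ.inner (𝕜 := ℝ) hN
  have h2 := hγ.inner (𝕜 := ℝ) hA
  have h3 := hw.inner (𝕜 := ℝ) hN
  unfold linearizedField reebSpeed reebSpeedDeriv
  refine ((continuousOn_const.div h1 hne).smul (hJ.comp_continuousOn hA)).add
    ((ContinuousOn.div (continuousOn_const.mul (h2.add h3)) (h1.pow 2)
      fun t ht => pow_ne_zero 2 (hne t ht)).smul (hJ.comp_continuousOn hN))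

/-- The derivative of the Reeb flow along an orbit solves the linearized Reeb equation. -/
theorem IsReebFlow.linearized_equation (hC : IsCompact C) (hs : HasSmoothBoundary C)
    (hpos : ∀ q ∈ frontier C, 0 < inner ℝ q (N C q)) {Ψ : ℝ → E4 → E4} (hΨ : IsReebFlow C Ψ)
    {p v : E4} (hp : p ∈ frontier C) (hv : v ∈ tangent C p) {T : ℝ}
    (hdiff : ∀ t ∈ Icc 0 T, DifferentiableWithinAt ℝ (Ψ t) (frontier C) p) :
    (∀ t ∈ Icc 0 T, fderivWithin ℝ (Ψ t) (frontier C) p v ∈ tangent C (Ψ t p)) ∧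
    ContinuousOn (fun t => fderivWithin ℝ (Ψ t) (frontier C) p v) (Icc 0 T) ∧
    ∀ t ∈ Ioo 0 T, HasDerivAt (fun t => fderivWithin ℝ (Ψ t) (frontier C) p v)
      (linearizedField C (Ψ t p) (fderivWithin ℝ (Ψ t) (frontier C) p v)) t := by
  have hcl := hC.isClosed
  obtain ⟨c, d, hd, hm, hcd⟩ := exists_seq_of_mem_tangent hcl hs hp hv
  obtain ⟨K, hK⟩ := exists_lipschitzOnWith_reebField hC hs hpos
  set w : ℝ → E4 := fun t => fderivWithin ℝ (Ψ t) (frontier C) p v with hw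
  -- The difference quotients `f m` converge pointwise to `w` and have time derivatives `g m`.
  -- Uniform bounds on both let the integrated equation pass to the limit.
  set f : ℕ → ℝ → E4 := fun m t => c m • (Ψ t (p + d m) - Ψ t p) with hf
  set g : ℕ → ℝ → E4 := fun m t => c m • (reebField C (Ψ t (p + d m)) - reebField C (Ψ t p))
    with hg
  have hlim : ∀ t ∈ Icc 0 T, Tendsto (fun m => f m t) atTop (𝓝 (w t)) := fun t ht =>
    (hdiff t ht).hasFDerivWithinAt.lim hd (Eventually.of_forall hm) hcd
  have hfg : ∀ m t, HasDerivAt (f m) (g m t) t := fun m t =>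
    ((hΨ.hasDerivAt (hm m) t).sub (hΨ.hasDerivAt hp t)).const_smul (c m)
  have hd0 : ∀ t ∈ Icc 0 T, Tendsto (fun m => Ψ t (p + d m) - Ψ t p) atTop (𝓝 0) := by
    intro t ht
    have h1 : Tendsto (fun m => p + d m) atTop (𝓝[frontier C] p) :=
      tendsto_nhdsWithin_iff.2 ⟨by simpa using hd.const_add p, Eventually.of_forall hm⟩
    simpa using ((hdiff t ht).continuousWithinAt.tendsto.comp h1).sub_const (Ψ t p)
  have hsub : ∀ m t, Ψ t p + (Ψ t (p + d m) - Ψ t p) ∈ frontier C := by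
    intro m t
    rw [add_sub_cancel]
    exact hΨ.mem_frontier (hm m) t
  have htan : ∀ t ∈ Icc 0 T, w t ∈ tangent C (Ψ t p) := fun t ht =>
    mem_tangent_of_tendsto hcl hs (hΨ.mem_frontier hp t) (hd0 t ht) (fun m => hsub m t) (hlim t ht)
  obtain ⟨B, hB⟩ := hcd.norm.bddAbove_range
  have hB' : ∀ m, ‖c m • d m‖ ≤ B := fun m => hB (mem_range_self m)
  have hfb : ∀ m, ∀ t ∈ Icc 0 T, ‖f m t‖ ≤ B * exp (K * T) := by
    intro m t ht
    have h1 := dist_le_of_trajectories_ODE_of_mem (v := fun _ => reebField C)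
      (s := fun _ => frontier C) (K := K) (f := fun s => Ψ s (p + d m)) (g := fun s => Ψ s p)
      (a := 0) (b := T) (δ := ‖d m‖) (fun _ _ => hK) (hΨ.continuous (hm m)).continuousOn
      (fun t _ => (hΨ.hasDerivAt (hm m) t).hasDerivWithinAt)
      (fun t _ => hΨ.mem_frontier (hm m) t) (hΨ.continuous hp).continuousOn
      (fun t _ => (hΨ.hasDerivAt hp t).hasDerivWithinAt) (fun t _ => hΨ.mem_frontier hp t)
      (by rw [(hΨ _ (hm m)).1, (hΨ p hp).1, dist_eq_norm, add_sub_cancel_left]) t ht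
    rw [dist_eq_norm, sub_zero] at h1
    calc ‖f m t‖ = ‖c m‖ * ‖Ψ t (p + d m) - Ψ t p‖ := norm_smul _ _
      _ ≤ ‖c m‖ * (‖d m‖ * exp (K * t)) := by gcongr
      _ = ‖c m • d m‖ * exp (K * t) := by rw [norm_smul]; ring
      _ ≤ B * exp (K * T) := by
        have hle := hB' m
        have h0 := norm_nonneg (c m • d m)
        have := ht.2
        gcongr
        linarith
  set L : ℝ := K * (B * exp (K * T)) with hL
  have hgb : ∀ m, ∀ t ∈ Icc 0 T, ‖g m t‖ ≤ L := by
    intro m t ht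
    have h1 := hK.norm_sub_le (hΨ.mem_frontier (hm m) t) (hΨ.mem_frontier hp t)
    calc ‖g m t‖ = ‖c m‖ * ‖reebField C (Ψ t (p + d m)) - reebField C (Ψ t p)‖ := norm_smul _ _
      _ ≤ ‖c m‖ * (K * ‖Ψ t (p + d m) - Ψ t p‖) := by gcongr
      _ = K * ‖f m t‖ := by rw [hf, norm_smul]; ring
      _ ≤ L := mul_le_mul_of_nonneg_left (hfb m t ht) K.coe_nonneg
  have hwc : ContinuousOn w (Icc 0 T) := by
    -- The Lipschitz bound common to all `f m` survives the pointwise limit. Continuity of `w` is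
    -- needed to differentiate the limiting integral.
    refine (LipschitzOnWith.of_dist_le_mul (K := L.toNNReal) fun t ht t' ht' => ?_).continuousOn
    have h1 : ∀ m, ‖f m t - f m t'‖ ≤ L * ‖t - t'‖ := fun m =>
      (convex_Icc 0 T).norm_image_sub_le_of_norm_hasDerivWithin_le
        (fun x _ => (hfg m x).hasDerivWithinAt) (fun x hx => hgb m x hx) ht' ht
    have h2 := le_of_tendsto ((hlim t ht).sub (hlim t' ht')).norm (Eventually.of_forall h1)
    rw [dist_eq_norm, dist_eq_norm]
    exact h2.trans (mul_le_mul_of_nonneg_right (Real.le_coe_toNNReal L) (norm_nonneg _))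
  have hγ := hΨ.continuous hp
  have hFc := continuousOn_linearizedField hcl hs hpos hγ.continuousOn hwc
    (fun t _ => hΨ.mem_frontier hp t) htan
  have hXc : ∀ q ∈ frontier C, Continuous fun s => reebField C (Ψ s q) := fun q hq =>
    hK.continuousOn.comp_continuous (hΨ.continuous hq) fun t => hΨ.mem_frontier hq t
  have hgc : ∀ m, Continuous (g m) := fun m => ((hXc _ (hm m)).sub (hXc p hp)).const_smul (c m)
  have hglim : ∀ t ∈ Icc 0 T, Tendsto (fun m => g m t) atTop
      (𝓝 (linearizedField C (Ψ t p) (w t))) := by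
    intro t ht
    obtain ⟨D, hD, hDw⟩ := exists_hasFDerivWithinAt_reebField hcl hs (hΨ.mem_frontier hp t)
      (hpos _ (hΨ.mem_frontier hp t))
    have := hD.lim (hd0 t ht) (Eventually.of_forall fun m => hsub m t) (hlim t ht)
    rw [hDw] at this
    simp only [add_sub_cancel] at this
    exact this
  have hint : ∀ t ∈ Icc 0 T, w t = w 0 + ∫ s in (0 : ℝ)..t, linearizedField C (Ψ s p) (w s) := by
    intro t ht
    have hsubset : uIoc 0 t ⊆ Icc 0 T := by
      rw [uIoc_of_le ht.1]
      exact fun s hs => ⟨hs.1.le, hs.2.trans ht.2⟩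
    have h0T : (0 : ℝ) ∈ Icc 0 T := ⟨le_rfl, ht.1.trans ht.2⟩
    have h1 := intervalIntegral.tendsto_integral_filter_of_dominated_convergence
      (μ := volume) (a := 0) (b := t) (l := atTop) (F := g)
      (f := fun s => linearizedField C (Ψ s p) (w s)) (fun _ => L)
      (Eventually.of_forall fun m => (hgc m).aestronglyMeasurable)
      (Eventually.of_forall fun m => Eventually.of_forall fun s hs => hgb m s (hsubset hs))
      (by simp) (Eventually.of_forall fun s hs => hglim s (hsubset hs))
    have h2 : ∀ m, ∫ s in (0 : ℝ)..t, g m s = f m t - f m 0 := fun m =>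
      intervalIntegral.integral_eq_sub_of_hasDerivAt (fun s _ => hfg m s)
        ((hgc m).intervalIntegrable _ _)
    simp only [h2] at h1
    rw [tendsto_nhds_unique h1 ((hlim t ht).sub (hlim 0 h0T))]
    abel
  refine ⟨htan, hwc, fun t ht => ?_⟩
  have h1 : HasDerivAt (fun u => ∫ s in (0 : ℝ)..u, linearizedField C (Ψ s p) (w s))
      (linearizedField C (Ψ t p) (w t)) t := by
    refine intervalIntegral.integral_hasDerivAt_right ?_ ?_
      (hFc.continuousAt (Icc_mem_nhds ht.1 ht.2))
    · refine (hFc.mono ?_).intervalIntegrable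
      rw [uIcc_of_le ht.1.le]
      exact Icc_subset_Icc_right ht.2.le
    · exact (hFc.mono Ioo_subset_Icc_self).stronglyMeasurableAtFilter isOpen_Ioo t ht
  refine (h1.const_add (w 0)).congr_of_eventuallyEq ?_
  filter_upwards [Icc_mem_nhds ht.1 ht.2] with u hu using hint u hu

/-! ### Total curvature of a regular curve -/

theorem totalCurvature_zero (γ : ℝ → E4) : totalCurvature γ 0 = 0 := by
  simp [totalCurvature, arcLength]

/-- The derivative of the total curvature of a curve with unit tangent vector `τ` and speed `k`,
with respect to the end point. -/
theorem hasDerivAt_totalCurvature {γ τ κ : ℝ → E4} {k : ℝ → ℝ} {k₀ : ℝ} (hk₀ : 0 < k₀)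
    (hk : Continuous k) (hkk : ∀ t, k₀ ≤ k t) (hτ1 : ∀ t, ‖τ t‖ = 1)
    (hγ : ∀ t, HasDerivAt γ (k t • τ t) t) (hτ : ∀ t, HasDerivAt τ (k t • κ t) t)
    (hκ : Continuous κ) (t : ℝ) :
    HasDerivAt (totalCurvature γ) (k t * ‖κ t‖) t := by
  have hkpos : ∀ t, 0 < k t := fun t => hk₀.trans_le (hkk t)
  set S := arcLength γ with hSdef
  have hS : ∀ t, HasDerivAt S (k t) t := by
    intro t
    have h1 : (fun s => ‖deriv γ s‖) = k := by
      funext s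
      rw [(hγ s).deriv, norm_smul, hτ1, mul_one, Real.norm_of_nonneg (hkpos s).le]
    have h2 : S = fun t => ∫ s in (0 : ℝ)..t, k s := by
      funext t; rw [hSdef, arcLength, h1]
    rw [h2]
    exact intervalIntegral.integral_hasDerivAt_right (hk.intervalIntegrable _ _)
      (hk.stronglyMeasurableAtFilter _ _) hk.continuousAt
  have hS0 : S 0 = 0 := by simp [hSdef, arcLength]
  have hmono : StrictMono S := strictMono_of_deriv_pos fun t => by
    rw [(hS t).deriv]; exact hkpos t
  have hScont : Continuous S := continuous_iff_continuousAt.2 fun t => (hS t).continuousAt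
  -- Speed bounded below makes arc length a bijection of the real line, so `Function.invFun` is a
  -- genuine two-sided inverse.
  have hmono' : Monotone fun t => S t - k₀ * t := by
    have h : ∀ t, HasDerivAt (fun t => S t - k₀ * t) (k t - k₀) t := fun t => by
      simpa using (hS t).fun_sub ((hasDerivAt_id t).const_mul k₀)
    refine monotone_of_deriv_nonneg (fun t => (h t).differentiableAt) fun t => ?_
    rw [(h t).deriv]; linarith [hkk t]
  have hsurj : Function.Surjective S := by
    refine hScont.surjective ?_ ?_
    · refine tendsto_atTop_mono' atTop ?_ (tendsto_id.const_mul_atTop hk₀)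
      filter_upwards [eventually_ge_atTop 0] with t ht
      have := hmono' ht
      simp only [hS0, mul_zero, sub_zero] at this
      simp only [id]; linarith
    · refine tendsto_atBot_mono' atBot ?_ (tendsto_id.const_mul_atBot hk₀)
      filter_upwards [eventually_le_atBot 0] with t ht
      have := hmono' ht
      simp only [hS0, mul_zero, sub_zero] at this
      simp only [id]; linarith
  set R := Function.invFun S with hR
  have hSR : ∀ s, S (R s) = s := Function.rightInverse_invFun hsurj
  have hRS : ∀ t, R (S t) = t := Function.leftInverse_invFun hmono.injective
  have hRcont : Continuous R := by
    have h1 : R = (hmono.orderIsoOfSurjective S hsurj).symm := by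
      funext s
      apply hmono.injective
      rw [hSR]
      exact ((hmono.orderIsoOfSurjective S hsurj).apply_symm_apply s).symm
    rw [h1]
    exact OrderIso.continuous _
  have hRd : ∀ s, HasDerivAt R (k (R s))⁻¹ s := fun s =>
    (hS (R s)).of_local_left_inverse hRcont.continuousAt (hkpos _).ne'
      (Eventually.of_forall hSR)
  have hd1 : deriv (arcLengthParam γ) = fun s => τ (R s) := by
    funext s
    have := ((hγ (R s)).scomp s (hRd s)).deriv
    rw [smul_smul, inv_mul_cancel₀ (hkpos _).ne', one_smul] at this
    exact this
  have hd2 : deriv (deriv (arcLengthParam γ)) = fun s => κ (R s) := by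
    rw [hd1]
    funext s
    have := ((hτ (R s)).scomp s (hRd s)).deriv
    rw [smul_smul, inv_mul_cancel₀ (hkpos _).ne', one_smul] at this
    exact this
  have hc : Continuous fun s => ‖κ (R s)‖ := (hκ.comp hRcont).norm
  have h1 : HasDerivAt (fun u => ∫ s in (0 : ℝ)..u, ‖κ (R s)‖) ‖κ (R (S t))‖ (S t) :=
    intervalIntegral.integral_hasDerivAt_right (hc.intervalIntegrable _ _)
      (hc.stronglyMeasurableAtFilter _ _) hc.continuousAt
  have h2 := h1.comp t (hS t)
  rw [hRS, mul_comm] at h2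
  have h3 : totalCurvature γ = (fun u => ∫ s in (0 : ℝ)..u, ‖κ (R s)‖) ∘ S := by
    funext t
    rw [totalCurvature, hd2]
    rfl
  rw [h3]
  exact h2

/-! ### The derivative of the polar angle -/

/-- A merely continuous angle is differentiable: after rotating the axes by `θ t`, it stays within
`π / 2` of `θ t` for nearby times, where it is an arctangent of a differentiable quotient. -/
theorem hasDerivAt_angle {x y r θ : ℝ → ℝ} {x' y' t : ℝ} (hx : HasDerivAt x x' t)
    (hy : HasDerivAt y y' t) (hθ : ContinuousAt θ t)
    (h : ∀ᶠ s in 𝓝 t, r s ≠ 0 ∧ x s = r s * cos (θ s) ∧ y s = r s * sin (θ s)) :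
    HasDerivAt θ ((x t * y' - y t * x') / (x t ^ 2 + y t ^ 2)) t := by
  obtain ⟨hr, hxt, hyt⟩ := h.self_of_nhds
  set c := cos (θ t)
  set s := sin (θ t)
  have hcs : s ^ 2 + c ^ 2 = 1 := sin_sq_add_cos_sq (θ t)
  have hden : x t * c + y t * s = r t := by
    rw [hxt, hyt]; linear_combination r t * hcs
  have hnum : y t * c - x t * s = 0 := by rw [hxt, hyt]; ring
  have hF := ((hy.mul_const c).sub (hx.mul_const s)).div ((hx.mul_const c).add (hy.mul_const s))
    (by simp only [Pi.add_apply]; rw [hden]; exact hr)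
  have hG := (hF.arctan).const_add (θ t)
  have hval : (1 / (1 + ((y t * c - x t * s) / (x t * c + y t * s)) ^ 2)) *
      (((y' * c - x' * s) * (x t * c + y t * s) - (y t * c - x t * s) * (x' * c + y' * s))
        / (x t * c + y t * s) ^ 2) = (x t * y' - y t * x') / (x t ^ 2 + y t ^ 2) := by
    have h2 : x t ^ 2 + y t ^ 2 = r t ^ 2 := by
      rw [hxt, hyt]; linear_combination r t ^ 2 * hcs
    rw [hnum, hden, h2, hxt, hyt]
    field_simp
    ring
  have hG' : HasDerivAt (fun u => θ t + arctan ((y u * c - x u * s) / (x u * c + y u * s)))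
      ((x t * y' - y t * x') / (x t ^ 2 + y t ^ 2)) t := by
    rw [← hval]
    exact hG
  refine hG'.congr_of_eventuallyEq ?_
  have hnear : ∀ᶠ u in 𝓝 t, θ u ∈ Ioo (θ t - π / 2) (θ t + π / 2) :=
    hθ.eventually (Ioo_mem_nhds (by linarith [pi_pos]) (by linarith [pi_pos]))
  filter_upwards [h, hnear] with u ⟨hru, hxu, hyu⟩ hu
  have h1 : y u * c - x u * s = r u * sin (θ u - θ t) := by rw [hxu, hyu, sin_sub]; ring
  have h2 : x u * c + y u * s = r u * cos (θ u - θ t) := by rw [hxu, hyu, cos_sub]; ring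
  rw [h1, h2, mul_div_mul_left _ _ hru, ← tan_eq_sin_div_cos,
    arctan_tan (by linarith [hu.1]) (by linarith [hu.2])]
  ring

/-! ### Rotation and total curvature -/

/-- Under the pinching condition, the total curvature of a Reeb orbit is bounded by the total
rotation of any solution of the linearized Reeb equation along it. -/
theorem totalCurvature_le_rotation (hC : IsCompact C) (hconv : Convex ℝ C)
    (h0 : (0 : E4) ∈ interior C) (hs : HasSmoothBoundary C) (a b c : E4 → ℝ)
    (hcurv : ∀ q ∈ frontier C, ArePrincipalCurvatures C q (a q) (b q) (c q))
    (hpinch : ∀ q ∈ frontier C, a q ≤ b q + c q)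
    {Ψ : ℝ → E4 → E4} (hΨ : IsReebFlow C Ψ) {p : E4} (hp : p ∈ frontier C) {T : ℝ} (hT : 0 ≤ T)
    {X : E2} {r : ℝ} (hr : IsTotalRotation T (fun t => linearizedFlow C Ψ p t X) r) :
    totalCurvature (fun t => Ψ t p) T ≤ r := by
  obtain ⟨θ, hθ, hu, rfl⟩ := hr
  have hcl := hC.isClosed
  have hpos : ∀ q ∈ frontier C, 0 < inner ℝ q (N C q) := fun q hq =>
    inner_N_pos hcl hconv h0 hs hq
  set γ : ℝ → E4 := fun t => Ψ t p with hγdef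
  have hγC : ∀ t, γ t ∈ frontier C := hΨ.mem_frontier hp
  have hγ : Continuous γ := hΨ.continuous hp
  have hγ' : ∀ t, HasDerivAt γ (reebSpeed C (γ t) • J (N C (γ t))) t := hΨ.hasDerivAt hp
  have hJ : Continuous J := J.continuous_of_finiteDimensional
  have hn : Continuous fun t => N C (γ t) := (continuousOn_N hcl hs).comp_continuous hγ hγC
  have hn' : ∀ t, HasDerivAt (fun t => N C (γ t))
      (reebSpeed C (γ t) • shapeOperator C (γ t) (J (N C (γ t)))) t := by
    intro t
    have := (hasFDerivWithinAt_N hcl hs (hγC t)).comp_hasDerivAt t (hγ' t)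
      (Eventually.of_forall hγC)
    rwa [map_smul] at this
  -- total curvature
  have hcurvature : ∀ t, HasDerivAt (totalCurvature γ)
      (reebSpeed C (γ t) * ‖shapeOperator C (γ t) (J (N C (γ t)))‖) t := by
    intro t
    -- A bound `R` for the norm on `C` bounds the support function, so the speed is at least `2 /
    -- R`.
    obtain ⟨R, hR⟩ := hC.isBounded.exists_norm_le
    have hR0 : ∀ q ∈ frontier C, inner ℝ q (N C q) ≤ R := fun q hq => by
      have h1 := real_inner_le_norm q (N C q)
      rw [norm_N hs hq, mul_one] at h1
      exact h1.trans (hR q (hcl.frontier_subset hq))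
    have hRpos : 0 < R := (hpos p hp).trans_le (hR0 p hp)
    have h := hasDerivAt_totalCurvature (k := fun t => reebSpeed C (γ t)) (k₀ := 2 / R)
      (τ := fun t => J (N C (γ t)))
      (κ := fun t => J (shapeOperator C (γ t) (J (N C (γ t))))) (by positivity)
      (continuous_const.div (hγ.inner (𝕜 := ℝ) hn) fun t => (hpos _ (hγC t)).ne')
      (fun t => div_le_div_of_nonneg_left (by norm_num) (hpos _ (hγC t)) (hR0 _ (hγC t)))
      (fun t => by rw [norm_J, norm_N hs (hγC t)]) hγ'
      (fun t => by
        rw [← map_smul]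
        exact J.toContinuousLinearMap.hasFDerivAt.comp_hasDerivAt t (hn' t))
      (hJ.comp (continuousOn_univ.1 (continuousOn_shapeOperator hcl hs hγ.continuousOn
        (hJ.comp hn).continuousOn (fun t _ => hγC t) fun t _ => J_N_mem_tangent _))) t
    simpa only [norm_J] using h
  -- linearized flow
  set v := trivInv C p X with hv
  have hvt : v ∈ tangent C p := by
    refine (trivInv_mem C p ?_ X).1
    rw [lambda0_eq_inner, inner_J_J]
    have := hpos p hp
    positivity
  have hdiff : ∀ t ∈ Icc 0 T, DifferentiableWithinAt ℝ (Ψ t) (frontier C) p := by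
    intro t ht
    -- Differentiability of the flow is implicit in the rotation: otherwise `fderivWithin` takes the
    -- default value `0` and the curve would vanish.
    by_contra hnd
    apply (hu t ht).1
    simp [linearizedFlow, fderivWithin_zero_of_not_differentiableWithinAt hnd]
  obtain ⟨htan, -, hODE⟩ := hΨ.linearized_equation hC hs hpos hp hvt hdiff
  set w : ℝ → E4 := fun t => fderivWithin ℝ (Ψ t) (frontier C) p v with hw
  have hu0 : ∀ t, linearizedFlow C Ψ p t X 0 = inner ℝ (Mhat (N C (γ t))) (w t) := fun t => rfl
  have hu1 : ∀ t, linearizedFlow C Ψ p t X 1 = inner ℝ (J (Mhat (N C (γ t)))) (w t) :=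
    fun t => rfl
  have hpolar : ∀ t ∈ Icc 0 T, ‖linearizedFlow C Ψ p t X‖ ≠ 0 ∧
      inner ℝ (Mhat (N C (γ t))) (w t) = ‖linearizedFlow C Ψ p t X‖ * cos (θ t) ∧
      inner ℝ (J (Mhat (N C (γ t)))) (w t) = ‖linearizedFlow C Ψ p t X‖ * sin (θ t) := by
    intro t ht
    obtain ⟨h1, h2⟩ := hu t ht
    have h3 := norm_ne_zero_iff.2 h1
    refine ⟨h3, ?_, ?_⟩
    · have h4 := congrArg (fun z : E2 => z 0) h2
      simp only [PiLp.smul_apply, smul_eq_mul, hu0] at h4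
      rw [inv_mul_eq_iff_eq_mul₀ h3] at h4
      simpa using h4
    · have h4 := congrArg (fun z : E2 => z 1) h2
      simp only [PiLp.smul_apply, smul_eq_mul, hu1] at h4
      rw [inv_mul_eq_iff_eq_mul₀ h3] at h4
      simpa using h4
  have hθ' : ∀ t ∈ Ioo 0 T, ∃ θ', HasDerivAt θ θ' t ∧
      reebSpeed C (γ t) * ‖shapeOperator C (γ t) (J (N C (γ t)))‖ ≤ θ' := by
    intro t ht
    have htI := Ioo_subset_Icc_self ht
    have hN1 := norm_N hs (hγC t)
    have hM' : HasDerivAt (fun t => Mhat (N C (γ t)))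
        (Mhat (reebSpeed C (γ t) • shapeOperator C (γ t) (J (N C (γ t))))) t :=
      Mhat.toContinuousLinearMap.hasFDerivAt.comp_hasDerivAt t (hn' t)
    have hJM' : HasDerivAt (fun t => J (Mhat (N C (γ t))))
        (J (Mhat (reebSpeed C (γ t) • shapeOperator C (γ t) (J (N C (γ t)))))) t :=
      J.toContinuousLinearMap.hasFDerivAt.comp_hasDerivAt t hM'
    have hx := hM'.inner ℝ (hODE t ht)
    have hy := hJM'.inner ℝ (hODE t ht)
    have hang := hasDerivAt_angle hx hy (hθ.continuousAt (Icc_mem_nhds ht.1 ht.2))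
      (r := fun t => ‖linearizedFlow C Ψ p t X‖)
      (by filter_upwards [Icc_mem_nhds ht.1 ht.2] with s hs using hpolar s hs)
    refine ⟨_, hang, ?_⟩
    have hwt : inner ℝ (N C (γ t)) (w t) = 0 := mem_tangent_iff.1 (htan t htI)
    have hrot := rotation_form hN1 hwt
      (fun v hv => mem_tangent_iff.1 (shapeOperator_mem_tangent hcl hs (hγC t)
        (mem_tangent_iff.2 hv))) (reebSpeed C (γ t)) (reebSpeedDeriv C (γ t) (w t))
    obtain ⟨hba, hcb, e, he, het, hAe⟩ := hcurv _ (hγC t)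
    set n := N C (γ t)
    set A := shapeOperator C (γ t)
    set x := inner ℝ (Mhat n) (w t)
    set y := inner ℝ (J (Mhat n)) (w t)
    have hU : ‖x • Mhat n + y • J (Mhat n)‖ ^ 2 = x ^ 2 + y ^ 2 := by
      have h1 : inner ℝ (Mhat n) (Mhat n) = ‖n‖ ^ 2 := by
        rw [← real_inner_self_eq_norm_sq, inner_E4, inner_E4]; simp only [Mhat]; simp; ring
      rw [← real_inner_self_eq_norm_sq]
      simp only [inner_add_left, inner_add_right, real_inner_smul_left, real_inner_smul_right,
        inner_J_J, inner_J_self, h1, hN1, real_inner_comm (Mhat n) (J (Mhat n))]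
      ring
    have hnJ : inner ℝ n (Mhat n) = 0 := by simp [inner_E4, Mhat]; ring
    have hnJM : inner ℝ n (J (Mhat n)) = 0 := by simp [inner_E4, J, Mhat]; ring
    have hpin := norm_le_of_pinching hN1 hba hcb (hpinch _ (hγC t)) he
      (fun i => mem_tangent_iff.1 (het i)) hAe (v := J n) (u := x • Mhat n + y • J (Mhat n))
      (by rw [norm_J, hN1]) (inner_J_self n)
      (by simp only [inner_add_right, real_inner_smul_right, hnJ, hnJM]; ring)
      (by
        simp only [inner_add_right, real_inner_smul_right, inner_J_J, hnJ]
        have : inner ℝ (J n) (Mhat n) = 0 := by simp [inner_E4, J, Mhat]; ring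
        rw [this]; ring)
    rw [hU] at hpin
    have hxy : 0 < x ^ 2 + y ^ 2 := by
      obtain ⟨h1, h2, h3⟩ := hpolar t htI
      change x = _ at h2
      change y = _ at h3
      rw [h2, h3, mul_pow, mul_pow, ← mul_add, cos_sq_add_sin_sq, mul_one]
      positivity
    have hk : 0 ≤ reebSpeed C (γ t) := div_nonneg (by norm_num) (hpos _ (hγC t)).le
    rw [le_div_iff₀ hxy]
    have h5 := mul_le_mul_of_nonneg_left hpin hk
    rw [← hrot] at h5
    refine le_trans (le_of_eq ?_) (h5.trans (le_of_eq ?_))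
    · ring
    · simp only [linearizedField]
      ring
  -- The rates are compared only in the open interval; continuity of `θ` carries the comparison to
  -- the end points.
  have hmono : MonotoneOn (fun t => θ t - totalCurvature γ t) (Icc 0 T) := by
    refine monotoneOn_of_deriv_nonneg (convex_Icc 0 T)
      (hθ.sub fun t _ => (hcurvature t).continuousAt.continuousWithinAt) ?_ ?_
    · rw [interior_Icc]
      intro t ht
      obtain ⟨θ', h1, -⟩ := hθ' t ht
      exact (h1.sub (hcurvature t)).differentiableAt.differentiableWithinAt
    · rw [interior_Icc]
      intro t ht
      obtain ⟨θ', h1, h2⟩ := hθ' t ht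
      rw [(h1.fun_sub (hcurvature t)).deriv]
      linarith
  have := hmono (left_mem_Icc.2 hT) (right_mem_Icc.2 hT) hT
  simp only [totalCurvature_zero] at this
  linarith

end ReebConvex

theorem corollary4p6
    (C : Set ReebConvex.E4) (hC : IsCompact C) (hconv : StrictConvex ℝ C)
    (h0 : (0 : ReebConvex.E4) ∈ interior C) (hsmooth : ReebConvex.HasSmoothBoundary C)
    (a b c : ReebConvex.E4 → ℝ)
    (hcurv : ∀ q ∈ frontier C, ReebConvex.ArePrincipalCurvatures C q (a q) (b q) (c q))
    (hpinch : ∀ q ∈ frontier C, a q ≤ b q + c q)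
    (Ψ : ℝ → ReebConvex.E4 → ReebConvex.E4) (hΨ : ReebConvex.IsReebFlow C Ψ)
    (p : ReebConvex.E4) (hp : p ∈ frontier C)
    (T : ℝ) (hT : 0 < T) (hper : Ψ T p = p)
    (hμ : ReebConvex.HasMaslovIndex T (ReebConvex.linearizedFlow C Ψ p) 3) :
    ReebConvex.totalCurvature (fun t => Ψ t p) T < 4 * Real.pi := by
  rcases hμ with ⟨k, hk, hrot⟩ | ⟨k, hk, -⟩
  · obtain rfl : k = 1 := by omega
    -- Any unit vector would do. The strict inequality comes from the strict upper bound `2 (k + 1)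
    -- π` at `k = 1`.
    obtain ⟨r, hr, -, hlt⟩ := hrot (EuclideanSpace.single 0 1) (by simp)
    refine (ReebConvex.totalCurvature_le_rotation hC hconv.convex h0 hsmooth a b c hcurv hpinch
      hΨ hp hT.le hr).trans_lt (hlt.trans_eq ?_)
    push_cast
    ring
  · omega
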